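/- Let $k$ be an algebraically closed field, let $\Gamma$ be a finite-dimensional (basic) local $k$-algebra, and let $G$ be a finite abelian group of $k$-algebra automorphisms of $\Gamma$ such that the group algebra $kG$ is semisimple. Let $R=\Gamma\rtimes kG$ be the smash product, i.e. the free left $\Gamma$-module on $G$ with multiplication $(a\rtimes g)(b\rtimes h)=a\,g(b)\rtimes gh$; we regard $\Gamma$ as the subalgebra $\Gamma\rtimes 1$. All modules are finite-dimensional left modules. For a $\Gamma$-module $C$ write $C^R=R\otimes_\Gamma C$, and for $g\in G$ let $C_g$ be the $\Gamma$-module with underlying space $C$ and action $t*c=g(t)c$. Let $S(C)=\{g\in G : C_g\cong C\}$ and let $T(C)$ be a transversal of $G/S(C)$. For an $R$-module or a sequence of $R$-modules, the subscript $\Gamma$ denotes restriction to $\Gamma$. For a finite-dimensional algebra $A$ let $G(A)$ be the free abelian group on the isomorphism classes of indecomposable $A$-modules; for $X\cong\bigoplus_i a_iV_i$ with $V_i$ indecomposable put $[X]=\sum_i a_i[V_i]$, and for a short exact sequence $Q:0\to X_1\to X_2\to X_3\to 0$ put $[[Q]]=[X_1]+[X_3]-[X_2]\in G(A)$. For an indecomposable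 non-projective $A$-module $V$ let $A(V)$ denote the Auslander--Reiten (almost split) sequence ending in $V$. Theorem. Let $M$ be an indecomposable non-projective $R$-module and $C$ an indecomposable $\Gamma$-module such that $M$ is a direct summand of $C^R$ with multiplicity $n\ge 1$ (that is, $C^R\cong M^n\oplus N$ with $M$ not a direct summand of $N$). Then $$[[A(M)_\Gamma]]=n\sum_{g\in T(C)}[[A(C_g)]]\qquad\text{in } G(\Gamma).$$ -/

import Mathlib

open CategoryTheory
open scoped TensorProduct

universe u v

noncomputable section

namespace SmashAR

section Rings

variable {A : Type v} [Ring A]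

/-- A module is indecomposable if it is nonzero and is not the direct sum of two nonzero
submodules. -/
def IsIndec (M : ModuleCat.{v} A) : Prop :=
  Nontrivial M ∧ ∀ p q : Submodule A M, IsCompl p q → p = ⊥ ∨ q = ⊥

variable (A) in
/-- Finitely generated indecomposable left `A`-modules. (Over a finite-dimensional algebra a module
is finitely generated exactly when it is finite-dimensional.) -/
structure IndecMod where
  carrier : ModuleCat.{v} A
  finite : Module.Finite A carrier
  indec : IsIndec carrier

variable (A) in
/-- Isomorphism of indecomposable modules. -/
instance isoSetoid : Setoid (IndecMod A) where
  r V W := Nonempty (V.carrier ≅ W.carrier)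
  iseqv := ⟨fun _ => ⟨Iso.refl _⟩, fun ⟨e⟩ => ⟨e.symm⟩, fun ⟨e⟩ ⟨f⟩ => ⟨e.trans f⟩⟩

variable (A) in
/-- Isomorphism classes of finitely generated indecomposable `A`-modules. -/
abbrev IndecClass : Type (v + 1) := Quotient (isoSetoid A)

variable (A) in
/-- `G(A)`: the free abelian group on the isomorphism classes of indecomposable modules. -/
abbrev GreenGroup : Type (v + 1) := IndecClass A →₀ ℤ

/-- `M` is a finite direct sum of finitely generated indecomposable modules. -/
def HasDecomposition (M : ModuleCat.{v} A) : Prop :=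
  ∃ (ι : Type) (_ : Fintype ι) (V : ι → IndecMod A),
    Nonempty (M ≃ₗ[A] ((i : ι) → (V i).carrier))

/-- Over an Artinian ring (in particular over a finite-dimensional algebra) every finitely
generated module has a decomposition into indecomposable modules. -/
theorem hasDecomposition_of_finite [IsArtinianRing A] (M : ModuleCat.{v} A)
    [Module.Finite A M] : HasDecomposition M := by
  have key : ∀ p : Submodule A M, HasDecomposition (ModuleCat.of A p) := by
    intro p
    induction p using WellFoundedLT.induction with
    | _ p ih =>
    by_cases hp : Nontrivial p
    · by_cases hi : ∀ r s : Submodule A p, IsCompl r s → r = ⊥ ∨ s = ⊥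
      · have hfin : Module.Finite A p := inferInstance
        exact ⟨Unit, inferInstance, fun _ => ⟨ModuleCat.of A p, hfin, hp, hi⟩,
          ⟨(LinearEquiv.funUnique Unit A p).symm⟩⟩
      · push Not at hi
        obtain ⟨r, s, hrs, hr, hs⟩ := hi
        have aux : ∀ r s : Submodule A p, IsCompl r s → s ≠ ⊥ →
            HasDecomposition (ModuleCat.of A r) := by
          intro r s hrs hs
          have hlt : r.map p.subtype < p := by
            refine lt_of_le_of_ne (Submodule.map_subtype_le p r) fun h => hs ?_
            have hr : r = ⊤ := by
              apply Submodule.map_injective_of_injective p.injective_subtype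
              rw [h, Submodule.map_subtype_top]
            have := hrs.inf_eq_bot
            simpa [hr] using this
          obtain ⟨ι, hι, V, ⟨e⟩⟩ := ih _ hlt
          exact ⟨ι, hι, V, ⟨(Submodule.equivMapOfInjective p.subtype p.injective_subtype r).trans e⟩⟩
        obtain ⟨ι, hι, V, ⟨e⟩⟩ := aux r s hrs hs
        obtain ⟨κ, hκ, W, ⟨f⟩⟩ := aux s r hrs.symm hr
        refine ⟨ι ⊕ κ, inferInstance, Sum.elim V W, ⟨?_⟩⟩
        exact ((Submodule.prodEquivOfIsCompl r s hrs).symm.trans (e.prodCongr f)).trans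
          (LinearEquiv.sumPiEquivProdPi A ι κ fun i => (Sum.elim V W i).carrier).symm
    · have : Subsingleton p := not_nontrivial_iff_subsingleton.mp hp
      exact ⟨Empty, inferInstance, fun i => i.elim, ⟨LinearEquiv.ofSubsingleton _ _⟩⟩
  obtain ⟨ι, hι, V, ⟨e⟩⟩ := key ⊤
  exact ⟨ι, hι, V, ⟨(Submodule.topEquiv (R := A) (M := M)).symm.trans e⟩⟩

open Classical in
/-- The class `[M] = ∑ aᵢ [Vᵢ]` in `G(A)`, where `M ≅ ⊕ aᵢ Vᵢ` with `Vᵢ` indecomposable. By the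
Krull-Schmidt theorem this does not depend on the chosen decomposition, which exists by
`hasDecomposition_of_finite` whenever `A` is Artinian and `M` is finitely generated. -/
def modClass (M : ModuleCat.{v} A) : GreenGroup A :=
  if h : HasDecomposition M then
    letI : Fintype h.choose := h.choose_spec.choose
    ∑ i, Finsupp.single (⟦h.choose_spec.choose_spec.choose i⟧ : IndecClass A) (1 : ℤ)
  else 0

/-- `[[E]] = [X₁] + [X₃] - [X₂]` for a short exact sequence `0 → X₁ → X₂ → X₃ → 0`. -/
def seqClass (E : ShortComplex (ModuleCat.{v} A)) : GreenGroup A :=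
  modClass E.X₁ + modClass E.X₃ - modClass E.X₂

/-- `f : X ⟶ Y` is left almost split in the category of finitely generated modules. -/
def LeftAlmostSplit {X Y : ModuleCat.{v} A} (f : X ⟶ Y) : Prop :=
  ¬ IsSplitMono f ∧ ∀ (Z : ModuleCat.{v} A), Module.Finite A Z → ∀ h : X ⟶ Z,
    ¬ IsSplitMono h → ∃ h' : Y ⟶ Z, f ≫ h' = h

/-- `g : Y ⟶ X` is right almost split in the category of finitely generated modules. -/
def RightAlmostSplit {Y X : ModuleCat.{v} A} (g : Y ⟶ X) : Prop :=
  ¬ IsSplitEpi g ∧ ∀ (Z : ModuleCat.{v} A), Module.Finite A Z → ∀ h : Z ⟶ X,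
    ¬ IsSplitEpi h → ∃ h' : Z ⟶ Y, h' ≫ g = h

/-- `E : 0 → X₁ → X₂ → X₃ → 0` is an Auslander-Reiten (almost split) sequence of finitely generated
modules. -/
structure IsARSequence (E : ShortComplex (ModuleCat.{v} A)) : Prop where
  finite₁ : Module.Finite A E.X₁
  finite₂ : Module.Finite A E.X₂
  finite₃ : Module.Finite A E.X₃
  shortExact : E.ShortExact
  left : LeftAlmostSplit E.f
  right : RightAlmostSplit E.g

/-- `E` is the Auslander-Reiten sequence `A(V)` ending in `V`. It is unique up to isomorphism. -/
def IsARSequenceOf (V : ModuleCat.{v} A) (E : ShortComplex (ModuleCat.{v} A)) : Prop :=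
  IsARSequence E ∧ Nonempty (E.X₃ ≅ V)

/-- `M` is isomorphic to a direct summand of `X`. -/
def IsSummand (M X : ModuleCat.{v} A) : Prop :=
  ∃ N : ModuleCat.{v} A, Nonempty (X ≃ₗ[A] M × N)

/-- `M` is a direct summand of `X` with multiplicity `n ≥ 1`: `X ≅ Mⁿ ⊕ N` where `M` is not a direct
summand of `N`. -/
def IsSummandWithMult (M X : ModuleCat.{v} A) (n : ℕ) : Prop :=
  0 < n ∧ ∃ N : ModuleCat.{v} A, Nonempty (X ≃ₗ[A] (Fin n → M) × N) ∧ ¬ IsSummand M N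

end Rings

section Induction

variable {A B : Type v} [Ring A] [Ring B] (φ : A →+* B)

/-- The relations `b φ(a) ⊗ c = b ⊗ a c` that cut `B ⊗_A C` out of `B ⊗_ℤ C`. -/
def inductionRelations (C : ModuleCat.{v} A) : Submodule B (B ⊗[ℤ] C) :=
  Submodule.span B {x | ∃ (b : B) (a : A) (c : C), x = (b * φ a) ⊗ₜ[ℤ] c - b ⊗ₜ[ℤ] (a • c)}

/-- The induced module `C^B = B ⊗_A C` along a homomorphism `φ : A → B` of (not necessarily
commutative) rings; `B` acts on the left factor. -/
def induced (C : ModuleCat.{v} A) : ModuleCat.{v} B :=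
  ModuleCat.of B ((B ⊗[ℤ] C) ⧸ inductionRelations φ C)

end Induction

section Smash

variable {k : Type u} [Field k] {Γ : Type v} [Ring Γ] [Algebra k Γ]

/-- The smash product `R = Γ ⋊ kG`, for a group `G` of `k`-algebra automorphisms of `Γ`: the free left
`Γ`-module on `G` with multiplication `(a ⋊ g)(b ⋊ h) = a g(b) ⋊ gh`. -/
abbrev Smash (G : Subgroup (Γ ≃ₐ[k] Γ)) : Type v := SkewMonoidAlgebra Γ G

/-- The embedding `Γ → Γ ⋊ kG`, `a ↦ a ⋊ 1`. -/
def incl (G : Subgroup (Γ ≃ₐ[k] Γ)) : Γ →+* Smash G where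
  toFun a := SkewMonoidAlgebra.single 1 a
  map_one' := rfl
  map_mul' a b := by simp [SkewMonoidAlgebra.single_mul_single]
  map_zero' := by simp
  map_add' a b := SkewMonoidAlgebra.single_add 1 a b

/-- The restriction functor `M ↦ M_Γ` from `R`-modules to `Γ`-modules. -/
abbrev restr (G : Subgroup (Γ ≃ₐ[k] Γ)) : ModuleCat.{v} (Smash G) ⥤ ModuleCat.{v} Γ :=
  ModuleCat.restrictScalars (incl G)

/-- The twist `C_g` of a `Γ`-module: the same abelian group with `t * c = g(t) c`. -/
def twist (g : Γ ≃ₐ[k] Γ) (C : ModuleCat.{v} Γ) : ModuleCat.{v} Γ :=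
  (ModuleCat.restrictScalars (g : Γ →+* Γ)).obj C

/-- `C₁ = C`. -/
def twistOne (C : ModuleCat.{v} Γ) : twist (1 : Γ ≃ₐ[k] Γ) C ≅ C :=
  (ModuleCat.restrictScalarsId (R := Γ)).app C

/-- `C_{gh} = (C_g)_h`. -/
def twistMul (g h : Γ ≃ₐ[k] Γ) (C : ModuleCat.{v} Γ) : twist (g * h) C ≅ twist h (twist g C) :=
  (ModuleCat.restrictScalarsComp (h : Γ →+* Γ) (g : Γ →+* Γ)).app C

/-- Twisting preserves isomorphisms. -/
def twistIso (g : Γ ≃ₐ[k] Γ) {C D : ModuleCat.{v} Γ} (e : C ≅ D) : twist g C ≅ twist g D :=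
  (ModuleCat.restrictScalars (g : Γ →+* Γ)).mapIso e

/-- The stabilizer `S(C) = {g ∈ G | C_g ≅ C}`. -/
def stab (G : Subgroup (Γ ≃ₐ[k] Γ)) (C : ModuleCat.{v} Γ) : Subgroup G where
  carrier := {g | Nonempty (twist (g : Γ ≃ₐ[k] Γ) C ≅ C)}
  one_mem' := ⟨twistOne C⟩
  mul_mem' := by
    rintro g h ⟨e⟩ ⟨f⟩
    exact ⟨(twistMul (g : Γ ≃ₐ[k] Γ) h C).trans ((twistIso _ e).trans f)⟩
  inv_mem' := by
    rintro g ⟨e⟩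
    have m := twistMul (g : Γ ≃ₐ[k] Γ) (g : Γ ≃ₐ[k] Γ)⁻¹ C
    rw [mul_inv_cancel] at m
    exact ⟨(twistIso _ e).symm.trans (m.symm.trans (twistOne C))⟩

end Smash

end SmashAR

end

/-! Elements of the Green group are tested by the functionals `homPairing`, the additive extensions
of `[V] ↦ dim Hom(X, V)`. These separate points (`eq_of_homPairing_indecMod_eq`). After cancelling
common terms, two disjoint families with equal Hom dimensions remain. By
`exists_retract_pi_of_finrank_hom_eq` the sum of one is a retract of a power of the sum of the
other, so locality of endomorphism rings gives a common member unless both families are empty.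

The functional of `X` on `[[A(V)]]` is the dimension of the cokernel of `Hom(X, E₂) → Hom(X, E₃)`.
By the almost split property and the algebraic closedness of `k`, it is the multiplicity of `V` in
`X` (`IsARSequenceOf.homPairing_eq_mult`).

By adjunction, `X` pairs with the restricted sequence as `X^R` pairs with `A(M)`
(`homPairing_seqClass_restr`). If `X` is a twist of `C`, it may be replaced by `C`, because
restricted `R`-modules do not distinguish twists, and the value is `n`. If `X` is not a twist of
`C`, then `M` is not a summand of `X^R`: the restriction of `X^R` is a sum of twists of `X`, so a
common summand `M` of `X^R` and `C^R` would make `X` and `C` twists of each other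
(`exists_iso_twist_of_common_summand`). The value is then 0. On the right, an indecomposable `X`
pairs to 1 with exactly one term of the sum or to 0 with all of them, in the same two cases. -/

namespace SmashAR

/-! ### Fitting's lemma and retracts of indecomposable modules. -/

section Retracts

variable {A : Type*} [Ring A]

/-- Fitting's lemma: the kernel and range of a high power of `f` are complementary, so one of them
vanishes. -/
theorem isUnit_or_isNilpotent_of_indecomposable {V : Type*} [AddCommGroup V] [Module A V]
    [IsArtinian A V] [IsNoetherian A V]
    (hV : ∀ p q : Submodule A V, IsCompl p q → p = ⊥ ∨ q = ⊥) (f : Module.End A V) :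
    IsUnit f ∨ IsNilpotent f := by
  obtain ⟨n, hn⟩ := Filter.eventually_atTop.mp (LinearMap.eventually_isCompl_ker_pow_range_pow f)
  -- The exponent `n + 1` is nonzero, so a unit power forces `f` itself to be a unit.
  have h := hn (n + 1) (Nat.le_succ n)
  rcases hV _ _ h with h0 | h0
  · left
    have htop : (f ^ (n + 1)).range = ⊤ := by
      have := h.sup_eq_top
      rwa [h0, bot_sup_eq] at this
    have hu : IsUnit (f ^ (n + 1)) := (Module.End.isUnit_iff _).2
      ⟨LinearMap.ker_eq_bot.1 h0, LinearMap.range_eq_top.1 htop⟩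
    exact (isUnit_pow_iff n.succ_ne_zero).1 hu
  · exact Or.inr ⟨n + 1, LinearMap.range_eq_bot.1 h0⟩

theorem isLocalRing_end_of_indecomposable {V : Type*} [AddCommGroup V] [Module A V]
    [IsArtinian A V] [IsNoetherian A V] [Nontrivial V]
    (hV : ∀ p q : Submodule A V, IsCompl p q → p = ⊥ ∨ q = ⊥) :
    IsLocalRing (Module.End A V) :=
  .of_isUnit_or_isUnit_one_sub_self fun f =>
    (isUnit_or_isNilpotent_of_indecomposable hV f).imp_right fun h => h.isUnit_one_sub

theorem exists_isUnit_of_isUnit_sum {S ι : Type*} [Semiring S] [IsLocalRing S] (s : Finset ι)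
    (f : ι → S) (h : IsUnit (∑ i ∈ s, f i)) : ∃ i ∈ s, IsUnit (f i) := by
  classical
  induction s using Finset.induction_on with
  | empty => exact absurd h (by simp)
  | insert a s ha ih =>
    rw [Finset.sum_insert ha] at h
    rcases IsLocalRing.isUnit_or_isUnit_of_isUnit_add h with h | h
    · exact ⟨a, by simp, h⟩
    · obtain ⟨i, hi, hu⟩ := ih h
      exact ⟨i, by simp [hi], hu⟩

/-- A nonzero retract of an indecomposable module is the whole module. -/
theorem bijective_of_isUnit_comp {V X : Type*} [AddCommGroup V] [Module A V] [Nontrivial V]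
    [AddCommGroup X] [Module A X] (hX : ∀ p q : Submodule A X, IsCompl p q → p = ⊥ ∨ q = ⊥)
    (s : V →ₗ[A] X) (r : X →ₗ[A] V) (h : IsUnit (r ∘ₗ s : Module.End A V)) :
    Function.Bijective r := by
  have hb := (Module.End.isUnit_iff _).1 h
  have hr : Function.Surjective r := Function.Surjective.of_comp (g := s) hb.2
  refine ⟨?_, hr⟩
  -- Since `r ∘ s` is invertible, `s` embeds `V` as a complement of `ker r`.
  have hc : IsCompl s.range r.ker := by
    constructor
    · rw [Submodule.disjoint_def]
      rintro _ ⟨v, rfl⟩ hv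
      have : v = 0 := hb.1 (by simpa using hv)
      simp [this]
    · rw [codisjoint_iff, eq_top_iff]
      rintro x -
      obtain ⟨v, hv⟩ := hb.2 (r x)
      refine Submodule.mem_sup.2 ⟨s v, ⟨v, rfl⟩, x - s v, ?_, by abel⟩
      have hv' : r (s v) = r x := hv
      simp [hv']
  rcases hX _ _ hc with h0 | h0
  · exfalso
    obtain ⟨v, hv⟩ := exists_ne (0 : V)
    refine hv (hb.1 ?_)
    have : s v = 0 := by simp [LinearMap.range_eq_bot.1 h0]
    simp [this]
  · exact LinearMap.ker_eq_bot.1 h0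

/-- An indecomposable module whose identity factors through finitely many indecomposable modules
is isomorphic to one of them. -/
theorem exists_linearEquiv_of_sum_comp_eq_id {V : Type*} [AddCommGroup V] [Module A V]
    [IsArtinian A V] [IsNoetherian A V] [Nontrivial V]
    (hV : ∀ p q : Submodule A V, IsCompl p q → p = ⊥ ∨ q = ⊥)
    {ι : Type*} [Fintype ι] (X : ι → Type*) [∀ i, AddCommGroup (X i)] [∀ i, Module A (X i)]
    (hX : ∀ i, ∀ p q : Submodule A (X i), IsCompl p q → p = ⊥ ∨ q = ⊥)
    (s : ∀ i, V →ₗ[A] X i) (r : ∀ i, X i →ₗ[A] V) (h : ∑ i, r i ∘ₗ s i = LinearMap.id) :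
    ∃ i, Nonempty (X i ≃ₗ[A] V) := by
  have := isLocalRing_end_of_indecomposable hV
  obtain ⟨i, -, hi⟩ := exists_isUnit_of_isUnit_sum (S := Module.End A V) Finset.univ
    (fun i => r i ∘ₗ s i) (by rw [h]; exact isUnit_one)
  exact ⟨i, ⟨LinearEquiv.ofBijective (r i) (bijective_of_isUnit_comp (hX i) (s i) (r i) hi)⟩⟩

end Retracts

/-! ### Dimensions of Hom spaces and left exactness. -/

section HomDim

variable (k : Type*) [Field k] {A : Type*} [Ring A] [Algebra k A]
variable {X Y Z : Type*}
  [AddCommGroup X] [Module A X]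
  [AddCommGroup Y] [Module A Y] [Module k Y] [IsScalarTower k A Y]
  [AddCommGroup Z] [Module A Z] [Module k Z] [IsScalarTower k A Z]

theorem finite_linearMap [Module.Finite k A] [Module.Finite A X] [Module.Finite A Y] :
    Module.Finite k (X →ₗ[A] Y) := by
  let _ : Module k X := Module.restrictScalars k A X
  have : IsScalarTower k A X := IsScalarTower.restrictScalars k A X
  have : Module.Finite k X := .trans A X
  have : Module.Finite k Y := .trans A Y
  exact Module.Finite.of_injective (LinearMap.restrictScalarsₗ k A X Y k)
    (LinearMap.restrictScalars_injective k)

/-- Left exactness of `Hom_A(X, -)`, in terms of dimensions. -/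
theorem finrank_hom_add_finrank_range_compRight [Module.Finite k A] [Module.Finite A X]
    [Module.Finite A Y] {K : Type*} [AddCommGroup K] [Module A K] [Module k K] [IsScalarTower k A K]
    (f : K →ₗ[A] Y) (g : Y →ₗ[A] Z) (hf : Function.Injective f) (hfg : Function.Exact f g) :
    Module.finrank k (X →ₗ[A] K) +
      Module.finrank k (LinearMap.compRight k (M := X) g).range =
        Module.finrank k (X →ₗ[A] Y) := by
  have := finite_linearMap k (A := A) (X := X) (Y := Y)
  rw [← LinearMap.finrank_range_add_finrank_ker (LinearMap.compRight k (M := X) g), add_comm]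
  congr 1
  have hinj : Function.Injective (LinearMap.compRight k (M := X) f) := fun a b hab =>
    LinearMap.ext fun x => hf (LinearMap.congr_fun hab x)
  suffices hr : (LinearMap.compRight k (M := X) f).range =
      (LinearMap.compRight k (M := X) g).ker by
    rw [← hr, LinearMap.finrank_range_of_inj hinj]
  ext h
  constructor
  · rintro ⟨a, rfl⟩
    exact LinearMap.ext fun x => hfg.apply_apply_eq_zero (a x)
  · intro hh
    have hx : ∀ x, h x ∈ f.range := fun x => (hfg (h x)).1 (LinearMap.congr_fun hh x)
    refine ⟨(LinearEquiv.ofInjective f hf).symm.toLinearMap ∘ₗ h.codRestrict _ hx, ?_⟩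
    ext x
    exact (LinearEquiv.ofInjective_apply f (h := hf) _).symm.trans (by simp)

/-- Left exactness of `Hom_A(-, Y)`, in terms of dimensions. -/
theorem finrank_quotient_hom_add_finrank_range_lcomp [Module.Finite k A] {W : Type*}
    [AddCommGroup W] [Module A W] [Module.Finite A W]
    [Module.Finite A Y] (g : X →ₗ[A] W) :
    Module.finrank k ((W ⧸ g.range) →ₗ[A] Y) + Module.finrank k (LinearMap.lcomp k Y g).range =
      Module.finrank k (W →ₗ[A] Y) := by
  have := finite_linearMap k (A := A) (X := W) (Y := Y)
  rw [← LinearMap.finrank_range_add_finrank_ker (LinearMap.lcomp k Y g), add_comm]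
  congr 1
  have hinj : Function.Injective (LinearMap.lcomp k Y g.range.mkQ) := fun a b hab =>
    LinearMap.ext fun x => by
      obtain ⟨x, rfl⟩ := g.range.mkQ_surjective x
      exact LinearMap.congr_fun hab x
  suffices hr : (LinearMap.lcomp k Y g.range.mkQ).range = (LinearMap.lcomp k Y g).ker by
    rw [← hr, LinearMap.finrank_range_of_inj hinj]
  ext h
  constructor
  · rintro ⟨a, rfl⟩
    refine LinearMap.ext fun x => ?_
    have : (Submodule.Quotient.mk (g x) : W ⧸ g.range) = 0 := by simp
    simp [this]
  · intro hh
    have hle : g.range ≤ h.ker := by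
      rintro _ ⟨x, rfl⟩
      exact LinearMap.congr_fun hh x
    exact ⟨g.range.liftQ h hle, g.range.liftQ_mkQ h hle⟩

theorem finrank_pi_hom {ι : Type*} [Fintype ι] (V : ι → Type*) [∀ i, AddCommGroup (V i)]
    [∀ i, Module A (V i)] [Module.Finite k A] [∀ i, Module.Finite A (V i)] [Module.Finite A Y] :
    Module.finrank k ((∀ i, V i) →ₗ[A] Y) = ∑ i, Module.finrank k (V i →ₗ[A] Y) := by
  classical
  have := fun i => finite_linearMap k (A := A) (X := V i) (Y := Y)
  rw [← (LinearMap.lsum A V (M := Y) k).finrank_eq, Module.finrank_pi_fintype]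

theorem finrank_hom_pi {ι : Type*} [Fintype ι] (V : ι → Type*) [∀ i, AddCommGroup (V i)]
    [∀ i, Module A (V i)] [∀ i, Module k (V i)] [∀ i, IsScalarTower k A (V i)]
    [Module.Finite k A] [Module.Finite A X] [∀ i, Module.Finite A (V i)] :
    Module.finrank k (X →ₗ[A] ∀ i, V i) = ∑ i, Module.finrank k (X →ₗ[A] V i) := by
  have := fun i => finite_linearMap k (A := A) (X := X) (Y := V i)
  rw [← Module.finrank_pi_fintype]
  exact LinearEquiv.finrank_eq
    { toFun := fun f i => LinearMap.proj i ∘ₗ f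
      invFun := fun f => LinearMap.pi f
      map_add' := fun _ _ => rfl
      map_smul' := fun _ _ => rfl
      left_inv := fun _ => rfl
      right_inv := fun _ => rfl }

theorem finrank_hom_congr_right (e : Y ≃ₗ[A] Z) :
    Module.finrank k (X →ₗ[A] Y) = Module.finrank k (X →ₗ[A] Z) :=
  LinearEquiv.finrank_eq <| .ofBijective (LinearMap.compRight k (M := X) e.toLinearMap)
    ⟨fun _ _ h => LinearMap.ext fun x => e.injective (LinearMap.congr_fun h x),
      fun f => ⟨e.symm.toLinearMap ∘ₗ f, by ext; simp⟩⟩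

/-- If `dim Hom(L, P) = dim Hom(L, Q)` for all finitely generated `L`, then `Q` is a retract of a
power of `P`. -/
theorem exists_retract_pi_of_finrank_hom_eq {A : Type v} [Ring A] [Algebra k A]
    [Module.Finite k A]
    {P Q : Type v} [AddCommGroup P] [Module A P] [Module k P] [IsScalarTower k A P]
    [AddCommGroup Q] [Module A Q] [Module k Q] [IsScalarTower k A Q]
    [Module.Finite A P] [Module.Finite A Q]
    (h : ∀ (L : Type v) [AddCommGroup L] [Module A L] [Module.Finite A L],
      Module.finrank k (L →ₗ[A] P) = Module.finrank k (L →ₗ[A] Q)) :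
    ∃ (m : ℕ) (g : Q →ₗ[A] (Fin m → P)) (r : (Fin m → P) →ₗ[A] Q), r ∘ₗ g = LinearMap.id := by
  have fQP := finite_linearMap k (A := A) (X := Q) (Y := P)
  have fQQ := finite_linearMap k (A := A) (X := Q) (Y := Q)
  obtain ⟨m, ⟨b⟩⟩ : ∃ m, Nonempty (Module.Basis (Fin m) k (Q →ₗ[A] P)) :=
    ⟨_, ⟨Module.finBasis k _⟩⟩
  -- With a basis of `Hom(Q, P)` as components, `g` is such that every map `Q → P` factors through
  -- it.
  let g : Q →ₗ[A] (Fin m → P) := LinearMap.pi b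
  refine ⟨_, g, ?_⟩
  have hP := finrank_quotient_hom_add_finrank_range_lcomp k (Y := P) g
  have hQ := finrank_quotient_hom_add_finrank_range_lcomp k (Y := Q) g
  have hs : (LinearMap.lcomp k P g).range = ⊤ := by
    rw [eq_top_iff, ← b.span_eq, Submodule.span_le]
    rintro _ ⟨i, rfl⟩
    exact ⟨LinearMap.proj i, rfl⟩
  -- Left exactness for the target `P` with every dimension transferred to the target `Q`: the maps
  -- `Q → Q` factoring through `g` have full dimension, so the identity factors.
  rw [hs, finrank_top, h, h Q, h (Fin m → P), ← hQ] at hP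
  have htop : (LinearMap.lcomp k Q g).range = ⊤ :=
    Submodule.eq_top_of_finrank_eq (Nat.add_left_cancel hP).symm
  obtain ⟨r, hr⟩ := LinearMap.range_eq_top.1 htop LinearMap.id
  exact ⟨r, hr⟩

end HomDim

/-! ### The Hom pairing on the Green group and its nondegeneracy. -/

section Pairing

open scoped ModuleCat

variable (k : Type u) [Field k] {A : Type v} [Ring A] [Algebra k A]

/-- The `k`-dimension of `Hom_A(X, Y)`. -/
noncomputable def homDim (X Y : ModuleCat.{v} A) : ℕ := Module.finrank k (X →ₗ[A] Y)

theorem homDim_congr_left {X Y : ModuleCat.{v} A} (Z : ModuleCat.{v} A) (e : X ≃ₗ[A] Y) :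
    homDim k X Z = homDim k Y Z :=
  (LinearEquiv.congrLeft Z k e).finrank_eq

theorem homDim_congr_right (X : ModuleCat.{v} A) {Y Z : ModuleCat.{v} A} (e : Y ≃ₗ[A] Z) :
    homDim k X Y = homDim k X Z :=
  finrank_hom_congr_right k e

/-- The function `[V] ↦ dim Hom(X, V)` on isomorphism classes. -/
noncomputable def homDimClass (X : ModuleCat.{v} A) : IndecClass A → ℕ :=
  Quotient.lift (fun V => homDim k X V.carrier)
    fun _ _ ⟨e⟩ => homDim_congr_right k X e.toLinearEquiv

/-- The additive extension of `[V] ↦ dim Hom(X, V)` to the Green group. -/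
noncomputable def homPairing (X : ModuleCat.{v} A) : GreenGroup A →+ ℤ :=
  Finsupp.liftAddHom fun c => zmultiplesHom ℤ (homDimClass k X c : ℤ)

@[simp]
theorem homPairing_single (X : ModuleCat.{v} A) (c : IndecClass A) (n : ℤ) :
    homPairing k X (Finsupp.single c n) = n * homDimClass k X c := by
  simp [homPairing]

theorem homPairing_congr {X Y : ModuleCat.{v} A} (e : X ≃ₗ[A] Y) :
    homPairing k X = homPairing k Y := by
  refine Finsupp.addHom_ext fun c n => ?_
  obtain ⟨V, rfl⟩ := Quotient.exists_rep c
  simp only [homPairing_single]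
  exact congrArg (fun m : ℕ => n * (m : ℤ)) (homDim_congr_left k V.carrier e)

variable [Module.Finite k A]

theorem homPairing_modClass (X M : ModuleCat.{v} A) [Module.Finite A X] [Module.Finite A M] :
    homPairing k X (modClass M) = homDim k X M := by
  have : IsArtinianRing A := .of_finite k A
  have h := hasDecomposition_of_finite M
  rw [modClass, dif_pos h]
  let _ : Fintype h.choose := h.choose_spec.choose
  have := fun i => (h.choose_spec.choose_spec.choose i).finite
  obtain ⟨e⟩ := h.choose_spec.choose_spec.choose_spec
  rw [homDim, finrank_hom_congr_right k e, finrank_hom_pi, map_sum, Nat.cast_sum]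
  exact Finset.sum_congr rfl fun i _ => by simp; rfl

theorem homPairing_seqClass (X : ModuleCat.{v} A) [Module.Finite A X]
    (E : ShortComplex (ModuleCat.{v} A)) [Module.Finite A E.X₁] [Module.Finite A E.X₂]
    [Module.Finite A E.X₃] :
    homPairing k X (seqClass E) = homDim k X E.X₁ + homDim k X E.X₃ - homDim k X E.X₂ := by
  simp [seqClass, homPairing_modClass]

theorem homPairing_pi {ι : Type} [Fintype ι] {X : ModuleCat.{v} A} (V : ι → ModuleCat.{v} A)
    [∀ i, Module.Finite A (V i)] (e : X ≃ₗ[A] ∀ i, V i) :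
    homPairing k X = ∑ i, homPairing k (V i) := by
  rw [homPairing_congr k (Y := ModuleCat.of A (∀ i, V i)) e]
  refine Finsupp.addHom_ext fun c n => ?_
  obtain ⟨W, rfl⟩ := Quotient.exists_rep c
  have := W.finite
  simp only [homPairing_single, AddMonoidHom.finsetSum_apply, ← Finset.mul_sum]
  exact_mod_cast congrArg (fun m : ℕ => n * (m : ℤ)) (finrank_pi_hom k (fun i => V i))

theorem homPairing_prod {X : ModuleCat.{v} A} (V W : ModuleCat.{v} A)
    [Module.Finite A V] [Module.Finite A W] (e : X ≃ₗ[A] V × W) :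
    homPairing k X = homPairing k V + homPairing k W := by
  rw [homPairing_congr k (Y := ModuleCat.of A (V × W)) e]
  refine Finsupp.addHom_ext fun c n => ?_
  obtain ⟨Z, rfl⟩ := Quotient.exists_rep c
  have := Z.finite
  have := finite_linearMap k (A := A) (X := V) (Y := Z.carrier)
  have := finite_linearMap k (A := A) (X := W) (Y := Z.carrier)
  have h := (LinearMap.coprodEquiv (R := A) (M := V) (M₂ := W) (M₃ := Z.carrier) k).finrank_eq
  rw [Module.finrank_prod] at h
  simp only [homPairing_single, AddMonoidHom.add_apply, ← mul_add]
  exact_mod_cast congrArg (fun m : ℕ => n * (m : ℤ)) h.symm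

/-- Two families of indecomposables, the second one nonempty, with the same `dim Hom(X, -)` for
all `X` have a common member. -/
theorem exists_iso_of_sum_homDim_eq {ι κ : Type} [Fintype ι] [Fintype κ]
    (V : ι → IndecMod A) (W : κ → IndecMod A)
    (h : ∀ X : ModuleCat.{v} A, Module.Finite A X →
      ∑ i, homDim k X (V i).carrier = ∑ j, homDim k X (W j).carrier) (j : κ) :
    ∃ i, V i ≈ W j := by
  classical
  have hV := fun i => (V i).finite
  have hW := fun j => (W j).finite
  obtain ⟨m, g, r, hrg⟩ := exists_retract_pi_of_finrank_hom_eq k (A := A)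
    (P := ∀ i, (V i).carrier) (Q := ∀ j, (W j).carrier) fun L _ _ _ => by
      rw [finrank_hom_pi, finrank_hom_pi]
      exact h (ModuleCat.of A L) ‹_›
  have : IsArtinianRing A := .of_finite k A
  have := (W j).indec.1
  -- The retraction factors the identity of `W j` through `m` copies of each `V i`, hence the index
  -- set `Fin m × ι`.
  obtain ⟨i, ⟨e⟩⟩ := exists_linearEquiv_of_sum_comp_eq_id (W j).indec.2
    (fun x : Fin m × ι => (V x.2).carrier) (fun x => (V x.2).indec.2)
    (fun x => LinearMap.proj x.2 ∘ₗ LinearMap.proj x.1 ∘ₗ g ∘ₗ LinearMap.single A (fun j => (W j).carrier) j)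
    (fun x => LinearMap.proj j ∘ₗ r ∘ₗ LinearMap.single A _ x.1 ∘ₗ LinearMap.single A (fun i => (V i).carrier) x.2) (by
      ext w
      have hy : ∀ y : Fin m → ∀ i, (V i).carrier,
          ∑ x : Fin m × ι, (Pi.single x.1 (Pi.single x.2 (y x.1 x.2)) :
            Fin m → ∀ i, (V i).carrier) = y := fun y => by
        rw [Fintype.sum_prod_type]
        have (l : Fin m) : ∑ i, (Pi.single l (Pi.single i (y l i)) :
            Fin m → ∀ i, (V i).carrier) = Pi.single l (y l) := by
          rw [← Finset.univ_sum_single (y l)]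
          rw [← LinearMap.single_apply (R := A) (φ := fun _ : Fin m => ∀ i, (V i).carrier), map_sum]
          simp
        simp_rw [this, Finset.univ_sum_single]
      have h1 := LinearMap.congr_fun hrg (Pi.single j w)
      rw [LinearMap.comp_apply, ← hy (g (Pi.single j w)), map_sum] at h1
      have h2 := congrFun h1 j
      simpa using h2)
  exact ⟨i.2, ⟨e.toModuleIso⟩⟩

theorem exists_mem_of_sum_homDimClass_eq {s t : Multiset (IndecClass A)}
    (h : ∀ X : ModuleCat.{v} A, Module.Finite A X →
      (s.map (homDimClass k X)).sum = (t.map (homDimClass k X)).sum)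
    {c : IndecClass A} (hc : c ∈ t) : c ∈ s := by
  induction s using Quotient.inductionOn with | _ s
  induction t using Quotient.inductionOn with | _ t
  obtain ⟨j, rfl⟩ := List.mem_iff_get.1 (Multiset.mem_coe.1 hc)
  have key (X : ModuleCat.{v} A) (l : List (IndecClass A)) :
      ∑ i, homDim k X (l.get i).out.carrier = (l.map (homDimClass k X)).sum := by
    rw [← Fin.sum_univ_fun_getElem]
    refine Finset.sum_congr rfl fun i _ => ?_
    conv_rhs => rw [← Quotient.out_eq l[i.1]]
    rfl
  obtain ⟨i, hi⟩ := exists_iso_of_sum_homDim_eq k (fun i => (s.get i).out)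
    (fun j => (t.get j).out) (fun X hX => by rw [key, key]; exact h X hX) j
  rw [← Quotient.out_equiv_out.1 hi]
  exact Multiset.mem_coe.2 (List.get_mem _ _)

/-- Separating positive and negative coefficients turns a relation in the group into a comparison of
two actual families of modules. -/
theorem exists_eq_sum_sub_sum (x : GreenGroup A) : ∃ s t : Multiset (IndecClass A),
    x = (s.map fun c => Finsupp.single c 1).sum - (t.map fun c => Finsupp.single c 1).sum := by
  induction x using Finsupp.induction_linear with
  | zero => exact ⟨0, 0, by simp⟩
  | add x y hx hy =>
    obtain ⟨s, t, rfl⟩ := hx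
    obtain ⟨s', t', rfl⟩ := hy
    exact ⟨s + s', t + t', by simp; abel⟩
  | single c n =>
    refine ⟨.replicate n.toNat c, .replicate (-n).toNat c, ?_⟩
    simp [← Finsupp.single_sub]

/-- The pairing `(X, [V]) ↦ dim Hom(X, V)` is nondegenerate on the Green group. -/
theorem eq_zero_of_homPairing_eq_zero {x : GreenGroup A}
    (h : ∀ X : ModuleCat.{v} A, Module.Finite A X → homPairing k X x = 0) : x = 0 := by
  classical
  obtain ⟨s, t, rfl⟩ := exists_eq_sum_sub_sum x
  have key : ∀ s : Multiset (IndecClass A), ∀ X : ModuleCat.{v} A,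
      homPairing k X (s.map fun c => Finsupp.single c 1).sum
        = ((s.map (homDimClass k X)).sum : ℕ) := by
    intro s X
    induction s using Multiset.induction_on with
    | empty => simp
    | cons c s ih => simp [ih]
  have hst : ∀ X : ModuleCat.{v} A, Module.Finite A X →
      (s.map (homDimClass k X)).sum = (t.map (homDimClass k X)).sum := fun X hX => by
    have := h X hX
    rw [map_sub, key, key, sub_eq_zero] at this
    exact_mod_cast this
  suffices s = t by simp [this]
  -- Cancelling the common part `s ∩ t` leaves disjoint multisets with equal Hom dimensions; any
  -- member of one would lie in the other.
  have hs : s - t + s ∩ t = s := Multiset.sub_add_inter s t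
  have ht : t - s + s ∩ t = t := by rw [Multiset.inter_comm]; exact Multiset.sub_add_inter t s
  have hdis : ∀ X : ModuleCat.{v} A, Module.Finite A X →
      ((s - t).map (homDimClass k X)).sum = ((t - s).map (homDimClass k X)).sum := fun X hX => by
    have e₁ := congrArg (fun u => (u.map (homDimClass k X)).sum) hs
    have e₂ := congrArg (fun u => (u.map (homDimClass k X)).sum) ht
    simp only [Multiset.map_add, Multiset.sum_add] at e₁ e₂
    have := hst X hX
    omega
  have hnot : ∀ c, ¬ (c ∈ s - t ∧ c ∈ t - s) := fun c ⟨h1, h2⟩ => by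
    rw [Multiset.mem_sub] at h1 h2
    omega
  have h1 : s - t = 0 := Multiset.eq_zero_of_forall_notMem fun c hc =>
    hnot c ⟨hc, exists_mem_of_sum_homDimClass_eq k (fun X hX => (hdis X hX).symm) hc⟩
  have h2 : t - s = 0 := Multiset.eq_zero_of_forall_notMem fun c hc =>
    hnot c ⟨exists_mem_of_sum_homDimClass_eq k hdis hc, hc⟩
  rw [h1] at hs
  rw [h2] at ht
  exact hs.symm.trans ht

/-- Elements of the Green group are separated by pairing with indecomposable modules. -/
theorem eq_of_homPairing_indecMod_eq {x y : GreenGroup A}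
    (h : ∀ X : IndecMod A, homPairing k X.carrier x = homPairing k X.carrier y) : x = y := by
  refine sub_eq_zero.1 (eq_zero_of_homPairing_eq_zero k fun X hX => ?_)
  have : IsArtinianRing A := .of_finite k A
  obtain ⟨ι, _, V, ⟨e⟩⟩ := hasDecomposition_of_finite X
  have := fun i => (V i).finite
  rw [homPairing_pi k (fun i => (V i).carrier) e]
  simp [h]

end Pairing

/-! ### Direct summands and split surjections. -/

section Indecomposable

variable {A : Type v} [Ring A]

/-- A nonzero summand of an indecomposable module is isomorphic to it. -/
theorem IsSummand.nonempty_linearEquiv {X Y : ModuleCat.{v} A} (h : IsSummand X Y)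
    (hX : Nontrivial X) (hY : IsIndec Y) : Nonempty (Y ≃ₗ[A] X) := by
  obtain ⟨N, ⟨e⟩⟩ := h
  refine ⟨LinearEquiv.ofBijective (LinearMap.fst A X N ∘ₗ e.toLinearMap) ?_⟩
  refine bijective_of_isUnit_comp hY.2 (e.symm.toLinearMap ∘ₗ LinearMap.inl A X N) _ ?_
  convert isUnit_one
  ext; simp

/-- The target of a surjection with a section is a summand of the source. -/
theorem isSummand_of_leftInverse {X Y : ModuleCat.{v} A} (r : Y →ₗ[A] X) (s : X →ₗ[A] Y)
    (h : r ∘ₗ s = LinearMap.id) : IsSummand X Y := by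
  have hrs (x : X) : r (s x) = x := LinearMap.congr_fun h x
  refine ⟨ModuleCat.of A r.ker, ⟨?_⟩⟩
  exact
    { toFun := fun y => (r y, ⟨y - s (r y), by simp [hrs]⟩)
      invFun := fun z => s z.1 + (z.2 : r.ker).1
      map_add' := fun a b => by
        refine Prod.ext (by simp) (Subtype.ext ?_)
        change a + b - s (r (a + b)) = a - s (r a) + (b - s (r b))
        simp only [map_add]
        abel
      map_smul' := fun c a => by
        refine Prod.ext (by simp) (Subtype.ext ?_)
        change c • a - s (r (c • a)) = c • (a - s (r a))
        simp only [map_smul, smul_sub]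
      left_inv := fun y => by simp
      right_inv := fun ⟨x, z, hz⟩ => by
        have hz : r z = 0 := hz
        refine Prod.ext (by simp [hrs, hz]) (Subtype.ext ?_)
        change s x + z - s (r (s x + z)) = z
        simp [hrs, hz] }

end Indecomposable

/-! ### Almost split sequences detect multiplicities. -/

section AlmostSplit

open scoped ModuleCat

variable (k : Type u) [Field k] {A : Type v} [Ring A] [Algebra k A] [Module.Finite k A]

/-- Pairing with `[[E]]` measures the cokernel of `Hom(X, E₂) → Hom(X, E₃)`. -/
theorem IsARSequence.homPairing_seqClass {E : ShortComplex (ModuleCat.{v} A)}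
    (hE : IsARSequence E) (X : ModuleCat.{v} A) [Module.Finite A X] :
    homPairing k X (seqClass E) = homDim k X E.X₃ -
      (Module.finrank k (LinearMap.compRight k (M := X) E.g.hom).range : ℤ) := by
  have := hE.finite₁
  have := hE.finite₂
  have := hE.finite₃
  rw [SmashAR.homPairing_seqClass]
  have h := finrank_hom_add_finrank_range_compRight k (X := X) E.f.hom E.g.hom
    hE.shortExact.moduleCat_injective_f
    ((ShortComplex.ShortExact.moduleCat_exact_iff_function_exact E).1 hE.shortExact.exact)
  have h' : (homDim k X E.X₁ : ℤ) +
    (Module.finrank k (LinearMap.compRight k (M := X) E.g.hom).range : ℤ) = homDim k X E.X₂ := by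
      exact_mod_cast h
  linarith

/-- A split epimorphism `X → E.X₃` would exhibit a summand, so every map from `X` lifts through
`E.g` and the cokernel is zero. -/
theorem IsARSequence.homPairing_eq_zero {E : ShortComplex (ModuleCat.{v} A)}
    (hE : IsARSequence E) (X : ModuleCat.{v} A) [Module.Finite A X] (hX : ¬ IsSummand E.X₃ X) :
    homPairing k X (seqClass E) = 0 := by
  have htop : (LinearMap.compRight k (M := X) E.g.hom).range = ⊤ := by
    refine LinearMap.range_eq_top.2 fun h => ?_
    obtain ⟨h', hh⟩ := hE.right.2 X ‹_› (ModuleCat.ofHom h) fun ⟨⟨s⟩⟩ =>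
      hX (isSummand_of_leftInverse h s.section_.hom
        (congrArg ModuleCat.Hom.hom s.id))
    exact ⟨h'.hom, congrArg ModuleCat.Hom.hom hh⟩
  rw [hE.homPairing_seqClass k, htop, finrank_top]
  simp [homDim]

theorem IsARSequence.nontrivial_X₃ {E : ShortComplex (ModuleCat.{v} A)}
    (hE : IsARSequence E) : Nontrivial E.X₃ := by
  by_contra h
  rw [not_nontrivial_iff_subsingleton] at h
  exact hE.right.1 ⟨⟨0, by ext x; exact Subsingleton.elim _ _⟩⟩

variable [IsAlgClosed k]

/-- The cokernel of `Hom(E₃, E₂) → End(E₃)` is spanned by the class of the identity, which is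
nonzero as `E.g` does not split. -/
theorem IsARSequence.homPairing_X₃ {E : ShortComplex (ModuleCat.{v} A)}
    (hE : IsARSequence E) : homPairing k E.X₃ (seqClass E) = 1 := by
  have := hE.finite₃
  have := hE.nontrivial_X₃
  have := finite_linearMap k (A := A) (X := E.X₃) (Y := E.X₃)
  have : Module.Finite k E.X₃ := .trans A E.X₃
  let S := (LinearMap.compRight k (M := E.X₃) E.g.hom).range
  have h1 : Module.finrank k ((E.X₃ →ₗ[A] E.X₃) ⧸ S) = 1 := by
    refine finrank_eq_one (S.mkQ LinearMap.id) ?_ ?_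
    · rw [Ne, Submodule.mkQ_apply, Submodule.Quotient.mk_eq_zero]
      rintro ⟨s, hs⟩
      exact hE.right.1 ⟨⟨ModuleCat.ofHom s, ModuleCat.hom_ext hs⟩⟩
    · intro w
      obtain ⟨h, rfl⟩ := S.mkQ_surjective w
      obtain ⟨c, hc⟩ := Module.End.exists_eigenvalue (h.restrictScalars k)
      obtain ⟨x, hx⟩ := hc.exists_hasEigenvector
      refine ⟨c, ?_⟩
      rw [← map_smul, eq_comm, ← sub_eq_zero, ← map_sub, Submodule.mkQ_apply,
        Submodule.Quotient.mk_eq_zero]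
      -- For an eigenvalue `c`, the map `h - c` is not injective, hence by finite dimension not
      -- surjective, so it is not a split epimorphism and lifts through `E.g`.
      obtain ⟨h', hh⟩ := hE.right.2 E.X₃ ‹_› (ModuleCat.ofHom (h - c • LinearMap.id))
        fun ⟨⟨s⟩⟩ => by
          have hs : Function.Surjective ((h - c • LinearMap.id : E.X₃ →ₗ[A] E.X₃).restrictScalars k) :=
            fun y => ⟨s.section_.hom y, congrArg (fun f => f.hom y) s.id⟩
          have hi := LinearMap.injective_iff_surjective.2 hs
          refine hx.2 (hi ?_)
          have : h x = c • x := hx.apply_eq_smul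
          simp [this]
      exact ⟨h'.hom, congrArg ModuleCat.Hom.hom hh⟩
  have h2 := S.finrank_quotient_add_finrank
  rw [h1] at h2
  rw [hE.homPairing_seqClass k, homDim, ← h2]
  simp [S]

theorem IsARSequenceOf.homPairing_eq_one {V : ModuleCat.{v} A} {E : ShortComplex (ModuleCat.{v} A)}
    (hE : IsARSequenceOf V E) {X : ModuleCat.{v} A} (e : X ≃ₗ[A] V) :
    homPairing k X (seqClass E) = 1 := by
  obtain ⟨hE, ⟨i⟩⟩ := hE
  rw [homPairing_congr k (e.trans i.symm.toLinearEquiv), hE.homPairing_X₃ k]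

omit [IsAlgClosed k] in
theorem IsARSequenceOf.homPairing_eq_zero {V : ModuleCat.{v} A}
    {E : ShortComplex (ModuleCat.{v} A)} (hE : IsARSequenceOf V E) (X : ModuleCat.{v} A)
    [Module.Finite A X] (hX : ¬ IsSummand V X) :
    homPairing k X (seqClass E) = 0 := by
  obtain ⟨hE, ⟨i⟩⟩ := hE
  refine hE.homPairing_eq_zero k X fun ⟨N, ⟨e⟩⟩ => hX ⟨N, ⟨e.trans
    (i.toLinearEquiv.prodCongr (LinearEquiv.refl A N))⟩⟩

/-- Pairing with `[[A(V)]]` computes the multiplicity of `V`. -/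
theorem IsARSequenceOf.homPairing_eq_mult {V : ModuleCat.{v} A}
    {E : ShortComplex (ModuleCat.{v} A)} (hE : IsARSequenceOf V E) {X : ModuleCat.{v} A}
    [Module.Finite A X] {n : ℕ} (hX : IsSummandWithMult V X n) :
    homPairing k X (seqClass E) = n := by
  obtain ⟨-, N, ⟨e⟩, hN⟩ := hX
  have : Module.Finite A V := by
    have := hE.1.finite₃
    exact .equiv hE.2.some.toLinearEquiv
  have : Module.Finite A N := .of_surjective (LinearMap.snd A (Fin n → V) N ∘ₗ e.toLinearMap)
    (Prod.snd_surjective.comp e.surjective)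
  rw [homPairing_prod k (ModuleCat.of A (Fin n → V)) N e,
    homPairing_pi k (X := ModuleCat.of A (Fin n → V)) (fun _ => V) (LinearEquiv.refl A _)]
  simp [hE.homPairing_eq_zero k N hN, hE.homPairing_eq_one k (LinearEquiv.refl A V)]

end AlmostSplit

/-! ### Induced modules and the induction–restriction adjunction. -/

section Induction

variable {A B : Type v} [Ring A] [Ring B] {φ : A →+* B} {C : ModuleCat.{v} A}

/-- The class of `b ⊗ c` in the induced module. -/
def inducedMk (φ : A →+* B) (b : B) (c : C) : induced φ C :=
  Submodule.Quotient.mk (p := inductionRelations φ C) (b ⊗ₜ[ℤ] c)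

theorem inducedMk_add_left (b b' : B) (c : C) :
    inducedMk φ (b + b') c = inducedMk φ b c + inducedMk φ b' c := by
  simp only [inducedMk, TensorProduct.add_tmul]; rfl

theorem inducedMk_add_right (b : B) (c c' : C) :
    inducedMk φ b (c + c') = inducedMk φ b c + inducedMk φ b c' := by
  simp only [inducedMk, TensorProduct.tmul_add]; rfl

theorem inducedMk_zero_right (b : B) : inducedMk φ b (0 : C) = 0 := by
  simp only [inducedMk, TensorProduct.tmul_zero]; rfl

theorem smul_inducedMk (b b' : B) (c : C) : b • inducedMk φ b' c = inducedMk φ (b * b') c := rfl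

theorem inducedMk_mul_map (b : B) (a : A) (c : C) :
    inducedMk φ (b * φ a) c = inducedMk φ b (a • c) :=
  (Submodule.Quotient.eq _).2 (Submodule.subset_span ⟨b, a, c, rfl⟩)

theorem induced_induction {p : induced φ C → Prop} (h0 : p 0) (hmk : ∀ b c, p (inducedMk φ b c))
    (hadd : ∀ x y, p x → p y → p (x + y)) (x : induced φ C) : p x := by
  obtain ⟨x, rfl⟩ := Submodule.Quotient.mk_surjective _ x
  induction x using TensorProduct.induction_on with
  | zero => exact h0
  | tmul b c => exact hmk b c
  | add x y hx hy => exact hadd _ _ hx hy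

/-- The universal property of the induced module for balanced biadditive maps. -/
def inducedLiftAdd {Z : Type*} [AddCommGroup Z] (β : B →+ C →+ Z)
    (hβ : ∀ b a c, β (b * φ a) c = β b (a • c)) : induced φ C →+ Z :=
  have hℤ (n : ℤ) (b : B) (c : C) : β (n • b) c = β b (n • c) := by
    rw [map_zsmul β n b, map_zsmul (β b) n c]; rfl
  QuotientAddGroup.lift (inductionRelations φ C).toAddSubgroup
    (TensorProduct.liftAddHom β hℤ) (by
      intro x hx
      -- The lift is only additive while the relations form a `B`-span; quantifying over all
      -- multiples `b • x` makes the induction close under scalars.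
      suffices h : ∀ b : B, TensorProduct.liftAddHom β hℤ (b • x) = 0 by
        simpa using h 1
      induction hx using Submodule.span_induction with
      | mem x hx =>
        obtain ⟨b, a, c, rfl⟩ := hx
        intro b'
        simp [smul_sub, TensorProduct.smul_tmul', ← mul_assoc, hβ]
      | zero => simp
      | add x y _ _ hx hy => intro b; simp [smul_add, hx, hy]
      | smul b x _ hx => intro b'; rw [smul_smul]; exact hx _)

@[simp]
theorem inducedLiftAdd_mk {Z : Type*} [AddCommGroup Z] (β : B →+ C →+ Z)
    (hβ : ∀ b a c, β (b * φ a) c = β b (a • c)) (b : B) (c : C) :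
    inducedLiftAdd β hβ (inducedMk φ b c) = β b c := rfl

/-- A map `C → Y` that is semilinear along `φ` extends to the induced module. -/
def inducedLift {Y : ModuleCat.{v} B} (f : C →+ Y) (hf : ∀ (a : A) (c : C), f (a • c) = φ a • f c) :
    induced φ C →ₗ[B] Y :=
  { inducedLiftAdd (Z := Y)
      (AddMonoidHom.mk' (fun b => (DistribSMul.toAddMonoidHom Y b).comp f)
        fun b b' => by ext c; simp [add_smul])
      (fun b a c => by simp [hf, mul_smul]) with
    map_smul' := fun b x => by
      induction x using induced_induction with
      | h0 => simp
      | hmk b' c => simp [smul_inducedMk, mul_smul]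
      | hadd x y hx hy => simp_all }

instance finite_induced [Module.Finite A C] : Module.Finite B (induced φ C) := by
  obtain ⟨s, hs⟩ := (inferInstance : Module.Finite A C).fg_top
  refine ⟨Submodule.fg_def.2 ⟨inducedMk φ 1 '' s, s.finite_toSet.image _, ?_⟩⟩
  have key : ∀ c : C, inducedMk φ 1 c ∈ Submodule.span B (inducedMk φ 1 '' (s : Set C)) := by
    intro c
    have hc : c ∈ Submodule.span A (s : Set C) := hs ▸ Submodule.mem_top
    induction hc using Submodule.span_induction with
    | mem c hc => exact Submodule.subset_span ⟨c, hc, rfl⟩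
    | zero => rw [inducedMk_zero_right]; exact zero_mem _
    | add c c' _ _ h h' => rw [inducedMk_add_right]; exact add_mem h h'
    | smul a c _ h =>
      rw [← inducedMk_mul_map, one_mul]
      simpa [smul_inducedMk] using Submodule.smul_mem _ (φ a) h
  refine eq_top_iff.2 fun x _ => ?_
  induction x using induced_induction with
  | h0 => exact zero_mem _
  | hmk b c => simpa [smul_inducedMk] using Submodule.smul_mem _ b (key c)
  | hadd x y hx hy => exact add_mem (hx trivial) (hy trivial)

open scoped ModuleCat in
/-- The adjunction between induction and restriction, in terms of dimensions. -/
theorem homDim_induced (k : Type u) [Field k] [Algebra k A] [Algebra k B]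
    (hφ : ∀ c : k, φ (algebraMap k A c) = algebraMap k B c) (Y : ModuleCat.{v} B) :
    homDim k (induced φ C) Y = homDim k C ((ModuleCat.restrictScalars φ).obj Y) := by
  refine LinearEquiv.finrank_eq
    { toFun := fun f =>
        { toFun := fun c => f (inducedMk φ 1 c)
          map_add' := fun c c' => by rw [inducedMk_add_right, map_add]; rfl
          map_smul' := fun a c => by
            rw [← inducedMk_mul_map, one_mul]
            change _ = φ a • f (inducedMk φ 1 c)
            rw [← map_smul, smul_inducedMk, mul_one] }
      invFun := fun f => inducedLift (Y := Y) f.toAddMonoidHom fun a c => f.map_smul a c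
      map_add' := fun f g => rfl
      map_smul' := fun c f => by
        ext x
        change algebraMap k B c • f (inducedMk φ 1 x) = φ (algebraMap k A c) • f (inducedMk φ 1 x)
        rw [hφ]
      left_inv := fun f => by
        ext x
        induction x using induced_induction with
        | h0 => simp
        | hmk b c =>
          change b • f (inducedMk φ 1 c) = _
          rw [← map_smul, smul_inducedMk, mul_one]
        | hadd x y hx hy => rw [map_add, map_add, hx, hy]
      right_inv := fun f => by
        ext x
        exact one_smul B (f x : Y) }

end Induction

/-! ### Twists, stabilizers and transversals. -/

section Twist

variable {k : Type u} [Field k] {Γ : Type v} [Ring Γ] [Algebra k Γ]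

/-- The identity map `C_g → C` as an equivalence that is semilinear along `g`. -/
def twistEquiv (g : Γ ≃ₐ[k] Γ) (C : ModuleCat.{v} Γ) :
    letI := RingHomInvPair.of_ringEquiv (g : Γ ≃+* Γ)
    letI := RingHomInvPair.of_ringEquiv_symm (g : Γ ≃+* Γ)
    twist g C ≃ₛₗ[((g : Γ ≃+* Γ) : Γ →+* Γ)] C :=
  letI := RingHomInvPair.of_ringEquiv (g : Γ ≃+* Γ)
  letI := RingHomInvPair.of_ringEquiv_symm (g : Γ ≃+* Γ)
  { toFun := fun x => x
    invFun := fun x => x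
    map_add' := fun _ _ => rfl
    map_smul' := fun _ _ => rfl
    left_inv := fun _ => rfl
    right_inv := fun _ => rfl }

theorem isIndec_twist (g : Γ ≃ₐ[k] Γ) {C : ModuleCat.{v} Γ} (hC : IsIndec C) :
    IsIndec (twist g C) := by
  refine ⟨hC.1, fun p q hpq => ?_⟩
  let := RingHomInvPair.of_ringEquiv (g : Γ ≃+* Γ)
  let := RingHomInvPair.of_ringEquiv_symm (g : Γ ≃+* Γ)
  -- Twisting does not change the lattice of submodules.
  have h := hC.2 _ _ ((Submodule.orderIsoMapComap (twistEquiv g C)).isCompl hpq)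
  simpa only [map_eq_bot_iff] using h

instance finite_twist (g : Γ ≃ₐ[k] Γ) (C : ModuleCat.{v} Γ) [Module.Finite Γ C] :
    Module.Finite Γ (twist g C) := by
  let := RingHomInvPair.of_ringEquiv (g : Γ ≃+* Γ)
  let := RingHomInvPair.of_ringEquiv_symm (g : Γ ≃+* Γ)
  exact Module.Finite.of_surjective (twistEquiv g C).symm.toLinearMap (twistEquiv g C).symm.surjective

/-- If `X_g ≅ D` then `X ≅ D_{g⁻¹}`. -/
theorem nonempty_iso_twist_inv (g : Γ ≃ₐ[k] Γ) {X D : ModuleCat.{v} Γ} (e : twist g X ≅ D) :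
    Nonempty (X ≅ twist g⁻¹ D) := by
  have m := twistMul g g⁻¹ X
  rw [mul_inv_cancel] at m
  exact ⟨(twistOne X).symm.trans (m.trans (twistIso _ e))⟩

variable {G : Subgroup (Γ ≃ₐ[k] Γ)} {C : ModuleCat.{v} Γ}

theorem mem_stab_of_twist_iso {g h : G}
    (e : twist (g : Γ ≃ₐ[k] Γ) C ≅ twist (h : Γ ≃ₐ[k] Γ) C) : g * h⁻¹ ∈ stab G C := by
  obtain ⟨e'⟩ := nonempty_iso_twist_inv _ e.symm
  exact ⟨(twistMul (g : Γ ≃ₐ[k] Γ) (h⁻¹ : Γ ≃ₐ[k] Γ) C).trans e'.symm⟩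

theorem nonempty_twist_mul_iso {s t : G} (hs : s ∈ stab G C) :
    Nonempty (twist ((s * t : G) : Γ ≃ₐ[k] Γ) C ≅ twist (t : Γ ≃ₐ[k] Γ) C) := by
  obtain ⟨e⟩ := hs
  exact ⟨(twistMul (s : Γ ≃ₐ[k] Γ) (t : Γ ≃ₐ[k] Γ) C).trans (twistIso _ e)⟩

variable [IsMulCommutative G] {T : Finset G}
  (hT : Subgroup.IsComplement (T : Set G) (stab G C : Set G))
include hT

/-- Every twist of `C` is isomorphic to a twist by a member of the transversal. -/
theorem exists_mem_transversal_twist_iso (g : G) :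
    ∃ t ∈ T, Nonempty (twist (g : Γ ≃ₐ[k] Γ) C ≅ twist (t : Γ ≃ₐ[k] Γ) C) := by
  obtain ⟨⟨⟨t, ht⟩, ⟨s, hs⟩⟩, rfl⟩ := hT.2 g
  refine ⟨t, ht, ?_⟩
  have := nonempty_twist_mul_iso (t := t) hs
  rwa [mul_comm'] at this

/-- The isomorphism puts `g * h⁻¹` in the stabilizer. Commutativity gives `g * 1 = h * (g * h⁻¹)`,
two factorizations of one element along the transversal, which must agree. -/
theorem eq_of_mem_transversal_of_twist_iso {g h : G} (hg : g ∈ T) (hh : h ∈ T)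
    (e : twist (g : Γ ≃ₐ[k] Γ) C ≅ twist (h : Γ ≃ₐ[k] Γ) C) : g = h := by
  have hs := mem_stab_of_twist_iso e
  have := @hT.1 (⟨g, hg⟩, ⟨1, one_mem _⟩) (⟨h, hh⟩, ⟨g * h⁻¹, hs⟩) (by
    change g * 1 = h * (g * h⁻¹)
    rw [mul_comm' h, mul_one, inv_mul_cancel_right])
  exact congrArg (fun x => (x.1 : G)) this

end Twist

/-! ### Restricting modules over the smash product. -/

section Smash

variable {k : Type u} [Field k] {Γ : Type v} [Ring Γ] [Algebra k Γ] {G : Subgroup (Γ ≃ₐ[k] Γ)}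

instance finite_smash [Finite G] [Module.Finite k Γ] : Module.Finite k (Smash G) :=
  have : Module.Finite Γ (Smash G) := .of_basis SkewMonoidAlgebra.basisSingleOne
  .trans Γ (Smash G)

open scoped ModuleCat in
theorem finite_restr [Finite G] [Module.Finite k Γ] (Y : ModuleCat.{v} (Smash G))
    [Module.Finite (Smash G) Y] : Module.Finite Γ ((restr G).obj Y) := by
  have h : Module.Finite k Y := .trans (Smash G) Y
  have : Module.Finite k ((restr G).obj Y) := h
  exact .of_restrictScalars_finite k Γ _

/-- The inclusion of the component `g ⊗ X ≅ X_{g⁻¹}` into the induced module. -/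
noncomputable def componentIncl (X : ModuleCat.{v} Γ) (g : G) :
    twist (g : Γ ≃ₐ[k] Γ)⁻¹ X →ₗ[Γ] (restr G).obj (induced (incl G) X) where
  toFun x := inducedMk (C := X) (incl G) (SkewMonoidAlgebra.single g 1) x
  map_add' x y := inducedMk_add_right (C := X) _ x y
  map_smul' a x := by
    change inducedMk (C := X) (incl G) (SkewMonoidAlgebra.single g 1)
        ((g : Γ ≃ₐ[k] Γ)⁻¹ a • (show X from x)) =
      (SkewMonoidAlgebra.single (1 : G) a : Smash G) •
        inducedMk (C := X) (incl G) (SkewMonoidAlgebra.single g 1) (show X from x)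
    -- The twist by `g⁻¹` arises from `(a ⋊ 1)(1 ⋊ g) = (1 ⋊ g)(g⁻¹(a) ⋊ 1)`.
    rw [← inducedMk_mul_map, smul_inducedMk]
    congr 1
    change _ * SkewMonoidAlgebra.single 1 _ = _
    have : g • ((g : Γ ≃ₐ[k] Γ)⁻¹ a) = a := (g : Γ ≃ₐ[k] Γ).apply_symm_apply a
    rw [SkewMonoidAlgebra.single_mul_single, SkewMonoidAlgebra.single_mul_single, this]
    simp

/-- The projection of the induced module onto the component `g ⊗ X ≅ X_{g⁻¹}`. -/
noncomputable def componentProj (X : ModuleCat.{v} Γ) (g : G) :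
    (restr G).obj (induced (incl G) X) →ₗ[Γ] twist (g : Γ ≃ₐ[k] Γ)⁻¹ X :=
  { inducedLiftAdd (φ := incl G) (C := X) (Z := X)
      -- The `g`-term of `b`, with coefficient `b_g`, equals `(1 ⋊ g)(g⁻¹(b_g) ⋊ 1)`, so `b ⊗ c` has
      -- `g`-component `g⁻¹(b_g) c`.
      (AddMonoidHom.mk' (fun b => DistribSMul.toAddMonoidHom X ((g : Γ ≃ₐ[k] Γ)⁻¹ (b.coeff g)))
        fun b b' => by ext c; simp [add_smul])
      (fun b a c => by
        have : (g : Γ ≃ₐ[k] Γ)⁻¹ (g • a) = a := (g : Γ ≃ₐ[k] Γ).symm_apply_apply a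
        change (g : Γ ≃ₐ[k] Γ)⁻¹ ((b * SkewMonoidAlgebra.single 1 a).coeff g) • c =
          (g : Γ ≃ₐ[k] Γ)⁻¹ (b.coeff g) • a • c
        rw [SkewMonoidAlgebra.coeff_mul_single_one, map_mul, this, mul_smul]) with
    map_smul' := fun a x => by
      change inducedLiftAdd (φ := incl G) (C := X) (Z := X) _ _
          ((SkewMonoidAlgebra.single (1 : G) a : Smash G) • (show induced (incl G) X from x)) =
        (g : Γ ≃ₐ[k] Γ)⁻¹ a • inducedLiftAdd (φ := incl G) (C := X) (Z := X) _ _ x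
      induction x using induced_induction (φ := incl G) (C := X) with
      | h0 => simp only [smul_zero, map_zero]
      | hmk b c =>
        change (g : Γ ≃ₐ[k] Γ)⁻¹ ((SkewMonoidAlgebra.single 1 a * b).coeff g) • c =
          (g : Γ ≃ₐ[k] Γ)⁻¹ a • (g : Γ ≃ₐ[k] Γ)⁻¹ (b.coeff g) • c
        rw [SkewMonoidAlgebra.coeff_single_one_mul, map_mul, mul_smul]
      | hadd x y hx hy => rw [smul_add, map_add, map_add, smul_add, hx, hy] }

/-- The restriction of `X^R` to `Γ` is the sum of its components. -/
theorem sum_componentIncl_comp_componentProj [Fintype G] (X : ModuleCat.{v} Γ) :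
    ∑ g : G, componentIncl X g ∘ₗ componentProj X g = LinearMap.id := by
  set F := ∑ g : G, componentIncl X g ∘ₗ componentProj X g
  refine LinearMap.ext fun x => ?_
  induction x using induced_induction (φ := incl G) (C := X) with
  | h0 => exact map_zero F
  | hmk b x =>
    refine (LinearMap.sum_apply _ _ _).trans ?_
    change ∑ g : G, inducedMk (C := X) (incl G) (SkewMonoidAlgebra.single g 1)
      ((g : Γ ≃ₐ[k] Γ)⁻¹ (b.coeff g) • x) = inducedMk (C := X) (incl G) b x
    have h (g : G) : inducedMk (C := X) (incl G) (SkewMonoidAlgebra.single g 1)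
        ((g : Γ ≃ₐ[k] Γ)⁻¹ (b.coeff g) • x) =
          inducedMk (C := X) (incl G) (SkewMonoidAlgebra.single g (b.coeff g)) x := by
      rw [← inducedMk_mul_map]
      congr 1
      change _ * SkewMonoidAlgebra.single 1 _ = _
      have : g • ((g : Γ ≃ₐ[k] Γ)⁻¹ (b.coeff g)) = b.coeff g :=
        (g : Γ ≃ₐ[k] Γ).apply_symm_apply _
      rw [SkewMonoidAlgebra.single_mul_single, this, mul_one, one_mul]
    simp only [h]
    let f : Smash G →+ induced (incl G) X :=
      AddMonoidHom.mk' (fun b => inducedMk (incl G) b x) fun b b' => inducedMk_add_left b b' x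
    change ∑ g : G, f (SkewMonoidAlgebra.single g (b.coeff g)) = f b
    rw [← map_sum, ← Finsupp.sum_fintype b.coeff SkewMonoidAlgebra.single
      fun _ => SkewMonoidAlgebra.single_zero _]
    exact congrArg f (SkewMonoidAlgebra.sum_single b)
  | hadd x y hx hy => exact (map_add F x y).trans (congrArg₂ (· + ·) hx hy)

open scoped ModuleCat in
/-- An `R`-module `Y` satisfies `Y_g ≅ Y` over `Γ`, so `Hom(C_g, Y) ≅ Hom(C, Y)`. -/
theorem homDim_twist (g : G) (C : ModuleCat.{v} Γ) (Y : ModuleCat.{v} (Smash G)) :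
    homDim k (twist (g : Γ ≃ₐ[k] Γ) C) ((restr G).obj Y) = homDim k C ((restr G).obj Y) := by
  have hinv (h h' : G) (hh : h * h' = 1) (y : Y) :
      SkewMonoidAlgebra.of Γ G h • SkewMonoidAlgebra.of Γ G h' • y = y := by
    rw [smul_smul, ← map_mul, hh, map_one, one_smul]
  have hcomm (h : G) (a : Γ) (y : Y) : SkewMonoidAlgebra.of Γ G h •
      (SkewMonoidAlgebra.single (1 : G) a : Smash G) • y =
        (SkewMonoidAlgebra.single (1 : G) (h • a) : Smash G) • SkewMonoidAlgebra.of Γ G h • y := by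
    rw [smul_smul, smul_smul]
    simp [SkewMonoidAlgebra.of_apply, SkewMonoidAlgebra.single_mul_single]
  -- The isomorphism is `f ↦ (1 ⋊ g) f`: by `hcomm`, the action of `1 ⋊ g` on `Y` is semilinear
  -- along `g`, which undoes the twist. It is `k`-linear because `g` fixes `k`.
  refine LinearEquiv.finrank_eq
    { toFun := fun f =>
        { toFun := fun c => (SkewMonoidAlgebra.of Γ G g • (show Y from f c) : Y)
          map_add' := fun c c' => (congrArg _ (map_add f c c')).trans (smul_add _ _ _)
          map_smul' := fun a c => ?_ }
      invFun := fun f =>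
        { toFun := fun c => (SkewMonoidAlgebra.of Γ G g⁻¹ • (show Y from f c) : Y)
          map_add' := fun c c' => (congrArg _ (map_add f c c')).trans (smul_add _ _ _)
          map_smul' := fun a c => ?_ }
      map_add' := fun f f' => by
        ext c
        exact smul_add (SkewMonoidAlgebra.of Γ G g) (show Y from f c) (show Y from f' c)
      map_smul' := fun c f => by
        ext x
        refine (hcomm g (algebraMap k Γ c) (show Y from f x)).trans ?_
        rw [smul_algebraMap]
        rfl
      left_inv := fun f => by
        ext c
        exact hinv _ _ (inv_mul_cancel g) (show Y from f c)
      right_inv := fun f => by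
        ext c
        exact hinv _ _ (mul_inv_cancel g) (show Y from f c) }
  · have hg : g • ((g : Γ ≃ₐ[k] Γ)⁻¹ a) = a := (g : Γ ≃ₐ[k] Γ).apply_symm_apply a
    have e : (((g : Γ ≃ₐ[k] Γ)⁻¹ a • (show twist (g : Γ ≃ₐ[k] Γ) C from c) :
        twist (g : Γ ≃ₐ[k] Γ) C) : C) = a • c := congrArg (· • c) hg
    refine (congrArg (fun z => (SkewMonoidAlgebra.of Γ G g • (show Y from f z) : Y))
      e.symm).trans ?_
    refine (congrArg (fun y : Y => SkewMonoidAlgebra.of Γ G g • y)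
      (f.map_smul ((g : Γ ≃ₐ[k] Γ)⁻¹ a) c)).trans ?_
    refine (hcomm g _ (show Y from f c)).trans ?_
    rw [hg]
    rfl
  · have hg : g⁻¹ • (g • a) = a := inv_smul_smul g a
    refine (congrArg (fun y : Y => SkewMonoidAlgebra.of Γ G g⁻¹ • y)
      (f.map_smul (g • a) c)).trans ?_
    refine (hcomm g⁻¹ _ (show Y from f c)).trans ?_
    rw [hg]
    rfl

end Smash

/-! ### Transfer between `Γ` and the smash product. -/

section Transfer

variable {k : Type u} [Field k] {Γ : Type v} [Ring Γ] [Algebra k Γ] [Module.Finite k Γ]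
  {G : Subgroup (Γ ≃ₐ[k] Γ)} [Finite G]

/-- The adjunction applied to each of the three terms. -/
theorem homPairing_seqClass_restr {E : ShortComplex (ModuleCat.{v} (Smash G))}
    (hE : IsARSequence E) (X : ModuleCat.{v} Γ) [Module.Finite Γ X] :
    homPairing k X (seqClass (E.map (restr G))) =
      homPairing k (induced (incl G) X) (seqClass E) := by
  have := hE.finite₁
  have := hE.finite₂
  have := hE.finite₃
  have : Module.Finite Γ (E.map (restr G)).X₁ := finite_restr E.X₁
  have : Module.Finite Γ (E.map (restr G)).X₂ := finite_restr E.X₂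
  have : Module.Finite Γ (E.map (restr G)).X₃ := finite_restr E.X₃
  rw [homPairing_seqClass, homPairing_seqClass]
  simp only [homDim_induced k (φ := incl G) (fun _ => rfl)]
  rfl

theorem homPairing_twist_seqClass_restr {E : ShortComplex (ModuleCat.{v} (Smash G))}
    (hE : IsARSequence E) (C : ModuleCat.{v} Γ) [Module.Finite Γ C] (g : G) :
    homPairing k (twist (g : Γ ≃ₐ[k] Γ) C) (seqClass (E.map (restr G))) =
      homPairing k C (seqClass (E.map (restr G))) := by
  have := hE.finite₁
  have := hE.finite₂
  have := hE.finite₃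
  have : Module.Finite Γ (E.map (restr G)).X₁ := finite_restr E.X₁
  have : Module.Finite Γ (E.map (restr G)).X₂ := finite_restr E.X₂
  have : Module.Finite Γ (E.map (restr G)).X₃ := finite_restr E.X₃
  rw [homPairing_seqClass, homPairing_seqClass]
  simp only [ShortComplex.map_X₁, ShortComplex.map_X₂, ShortComplex.map_X₃, homDim_twist]

/-- If `M` is a summand of `X^R` with `X` indecomposable, then every indecomposable summand of `M_Γ`
is a twist of `X`. -/
theorem exists_twist_linearEquiv_of_retract {M : ModuleCat.{v} (Smash G)} {X V : ModuleCat.{v} Γ}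
    (hX : IsIndec X) (hV : IsIndec V) [Module.Finite Γ V]
    (hM : IsSummand M (induced (incl G) X)) (s : V →ₗ[Γ] (restr G).obj M)
    (r : (restr G).obj M →ₗ[Γ] V) (hrs : r ∘ₗ s = LinearMap.id) :
    ∃ g : G, Nonempty (twist (g : Γ ≃ₐ[k] Γ)⁻¹ X ≃ₗ[Γ] V) := by
  have : IsArtinianRing Γ := .of_finite k Γ
  have := hV.1
  have := Fintype.ofFinite G
  obtain ⟨N, ⟨e⟩⟩ := hM
  let i : (restr G).obj M →ₗ[Γ] (restr G).obj (induced (incl G) X) :=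
    ((restr G).map (ModuleCat.ofHom (e.symm.toLinearMap ∘ₗ LinearMap.inl _ M N))).hom
  let p : (restr G).obj (induced (incl G) X) →ₗ[Γ] (restr G).obj M :=
    ((restr G).map (ModuleCat.ofHom (LinearMap.fst _ M N ∘ₗ e.toLinearMap))).hom
  have hpi : p ∘ₗ i = LinearMap.id := by
    refine LinearMap.ext fun m => ?_
    exact congrArg Prod.fst (e.apply_symm_apply (m, 0))
  refine exists_linearEquiv_of_sum_comp_eq_id hV.2 _ (fun g : G => (isIndec_twist _ hX).2)
    (fun g => componentProj X g ∘ₗ i ∘ₗ s) (fun g => r ∘ₗ p ∘ₗ componentIncl X g) ?_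
  -- The identity of `V` factors through the restriction of `X^R`, hence through its components,
  -- which are twists of `X`.
  have key : r ∘ₗ p ∘ₗ (∑ g : G, componentIncl X g ∘ₗ componentProj X g) ∘ₗ i ∘ₗ s =
      LinearMap.id := by
    rw [sum_componentIncl_comp_componentProj, LinearMap.id_comp, ← LinearMap.comp_assoc s i p,
      hpi, LinearMap.id_comp, hrs]
  rw [← key]
  ext v
  simp

/-- Indecomposable `Γ`-modules whose induced modules share a nonzero summand are twists of each
other. -/
theorem exists_iso_twist_of_common_summand {M : ModuleCat.{v} (Smash G)} [Nontrivial M]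
    [Module.Finite (Smash G) M] {X C : ModuleCat.{v} Γ} (hX : IsIndec X) (hC : IsIndec C)
    (hMX : IsSummand M (induced (incl G) X)) (hMC : IsSummand M (induced (incl G) C)) :
    ∃ g : G, Nonempty (X ≅ twist (g : Γ ≃ₐ[k] Γ) C) := by
  classical
  have : IsArtinianRing Γ := .of_finite k Γ
  have := finite_restr M
  -- Any one indecomposable summand of `M_Γ` is a twist both of `X` and of `C`, which links the two.
  obtain ⟨ι, _, V, ⟨e⟩⟩ := hasDecomposition_of_finite ((restr G).obj M)
  obtain ⟨i⟩ : Nonempty ι := by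
    by_contra h
    rw [not_nonempty_iff] at h
    have : Subsingleton M := e.toEquiv.subsingleton
    exact not_subsingleton M this
  have := (V i).finite
  let s : (V i).carrier →ₗ[Γ] (restr G).obj M :=
    e.symm.toLinearMap ∘ₗ LinearMap.single Γ (fun i => (V i).carrier) i
  let r : (restr G).obj M →ₗ[Γ] (V i).carrier := LinearMap.proj i ∘ₗ e.toLinearMap
  have hrs : r ∘ₗ s = LinearMap.id := by ext; simp [r, s]
  obtain ⟨g, ⟨a⟩⟩ := exists_twist_linearEquiv_of_retract hX (V i).indec hMX s r hrs
  obtain ⟨h, ⟨b⟩⟩ := exists_twist_linearEquiv_of_retract hC (V i).indec hMC s r hrs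
  obtain ⟨c⟩ := nonempty_iso_twist_inv (X := X) (D := twist (h : Γ ≃ₐ[k] Γ)⁻¹ C) _
    (a.trans b.symm).toModuleIso
  rw [inv_inv] at c
  exact ⟨h⁻¹ * g, ⟨c.trans (twistMul (h : Γ ≃ₐ[k] Γ)⁻¹ (g : Γ ≃ₐ[k] Γ) C).symm⟩⟩

theorem IsSummandWithMult.isSummand {A : Type v} [Ring A] {M X : ModuleCat.{v} A} {n : ℕ}
    (h : IsSummandWithMult M X n) : IsSummand M X := by
  obtain ⟨hn, N, ⟨e⟩, -⟩ := h
  obtain ⟨n, rfl⟩ := Nat.exists_eq_succ_of_ne_zero hn.ne'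
  refine isSummand_of_leftInverse (LinearMap.proj 0 ∘ₗ LinearMap.fst A (Fin (n + 1) → M) N ∘ₗ
    e.toLinearMap) (e.symm.toLinearMap ∘ₗ LinearMap.inl A (Fin (n + 1) → M) N ∘ₗ
      LinearMap.single A (fun _ => M) 0) ?_
  ext; simp

end Transfer

end SmashAR

/-! ### The theorem. -/

theorem mainTheorem11 {k : Type u} [Field k] [IsAlgClosed k]
    {Γ : Type v} [Ring Γ] [Algebra k Γ] [Module.Finite k Γ] [IsLocalRing Γ]
    (G : Subgroup (Γ ≃ₐ[k] Γ)) [Finite G] [IsMulCommutative G]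
    [IsSemisimpleRing (MonoidAlgebra k G)]
    (M : ModuleCat.{v} (SmashAR.Smash G)) [Module.Finite (SmashAR.Smash G) M]
    (hM : SmashAR.IsIndec M)
    (C : ModuleCat.{v} Γ) [Module.Finite Γ C] (hC : SmashAR.IsIndec C)
    (n : ℕ) (hn : SmashAR.IsSummandWithMult M (SmashAR.induced (SmashAR.incl G) C) n)
    (T : Finset G) (hT : Subgroup.IsComplement (T : Set G) (SmashAR.stab G C : Set G))
    (E : ShortComplex (ModuleCat.{v} (SmashAR.Smash G))) (hE : SmashAR.IsARSequenceOf M E)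
    (F : G → ShortComplex (ModuleCat.{v} Γ))
    (hF : ∀ g ∈ T, SmashAR.IsARSequenceOf (SmashAR.twist (g : Γ ≃ₐ[k] Γ) C) (F g)) :
    SmashAR.seqClass (E.map (SmashAR.restr G)) = n • ∑ g ∈ T, SmashAR.seqClass (F g) := by
  refine SmashAR.eq_of_homPairing_indecMod_eq k fun X => ?_
  have := X.finite
  have := hM.1
  rw [map_nsmul, map_sum]
  by_cases h : ∃ g : G, Nonempty (X.carrier ≅ SmashAR.twist (g : Γ ≃ₐ[k] Γ) C)
  -- `X` is a twist of `C`: the left side is the multiplicity of `M` in `C^R`, and on the right only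
  -- the representative `t` contributes.
  · obtain ⟨g, ⟨e⟩⟩ := h
    obtain ⟨t, ht, ⟨f⟩⟩ := SmashAR.exists_mem_transversal_twist_iso hT g
    rw [SmashAR.homPairing_congr k (e.trans f).toLinearEquiv,
      SmashAR.homPairing_twist_seqClass_restr hE.1, SmashAR.homPairing_seqClass_restr hE.1,
      hE.homPairing_eq_mult k hn, Finset.sum_eq_single_of_mem t ht fun t' ht' hne => ?_,
      (hF t ht).homPairing_eq_one k (LinearEquiv.refl Γ _)]
    · simp
    · refine (hF t' ht').homPairing_eq_zero k _ fun hs => hne ?_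
      obtain ⟨i⟩ := hs.nonempty_linearEquiv (SmashAR.isIndec_twist _ hC).1
        (SmashAR.isIndec_twist _ hC)
      exact SmashAR.eq_of_mem_transversal_of_twist_iso hT ht' ht i.symm.toModuleIso
  -- `X` is not a twist of `C`: both sides vanish, as a nonzero value on either side would make it
  -- one.
  · rw [SmashAR.homPairing_seqClass_restr hE.1, hE.homPairing_eq_zero k _ fun hs => h
        (SmashAR.exists_iso_twist_of_common_summand X.indec hC hs hn.isSummand),
      Finset.sum_eq_zero fun t ht => (hF t ht).homPairing_eq_zero k _ fun hs => h ⟨t, ?_⟩,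
      smul_zero]
    obtain ⟨i⟩ := hs.nonempty_linearEquiv (SmashAR.isIndec_twist _ hC).1 X.indec
    exact ⟨i.toModuleIso⟩
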